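/- A deterministic one-tape Turing machine (DTM) is a tuple $M=(Q,\Sigma,\Gamma,\delta,q_0,F)$ with finite sets $Q$ of states and $\Gamma$ of working symbols, a blank symbol $b\in\Gamma$, an input alphabet $\Sigma\subseteq\Gamma\setminus\{b\}$, an initial state $q_0\in Q$, final states $F\subseteq Q$, and a partial transition function $\delta\colon Q\times\Gamma\to Q\times(\Gamma\setminus\{b\})\times\{-1,+1\}$. It works on a bi-infinite tape; on input $w\in\Sigma^*$ it starts in state $q_0$ on the leftmost symbol of $w$ (on a blank cell if $w$ is empty), all cells outside $w$ being blank, and it halts when no transition applies. $M$ is weight-reducing if there is a partial order $<$ on $\Gamma$ such that $\delta(p,\sigma)=(q,\tau,d)$ always implies $\tau<\sigma$. $M$ works in linear time if there are constants $K,C\in\mathbb{N}$ such that on every input $w\in\Sigma^*$ its computation halts within $K|w|+C$ steps. It is decidable whether a given weight-reducing DTM works in linear time. That is, encoding machines with $Q=\{0,\dots,n-1\}$ and $\Gamma=\{0,\dots,g-1\}$ by their finite descriptions $\langle M\rangle$, the set $$\{\langle M\rangle : M \text{ is a weight-reducing DTM that works in linear time}\}$$ is decidable. -/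

import Mathlib

/-- A deterministic one-tape Turing machine with set of states `Q` and working alphabet `Γ`.
The transition function `δ` is partial (`none` means undefined), every transition writes
a non-blank symbol and moves the head by one cell. -/
structure DTM (Q Γ : Type) where
  /-- the blank symbol -/
  blank : Γ
  /-- the input alphabet, a subset of the working alphabet not containing the blank -/
  input : Finset Γ
  blank_notMem_input : blank ∉ input
  /-- the partial transition function -/
  δ : Q → Γ → Option (Q × Γ × Turing.Dir)
  blank_not_written : ∀ p σ q τ d, δ p σ = some (q, τ, d) → τ ≠ blank
  /-- the initial state -/
  start : Q
  /-- the set of final states -/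
  final : Finset Q

namespace DTM

/-- A configuration: the state, the contents of the bi-infinite tape, and the head position. -/
structure Config (Q Γ : Type) where
  state : Q
  tape : ℤ → Γ
  head : ℤ

/-- The displacement of the head. -/
def shift : Turing.Dir → ℤ
  | Turing.Dir.left => -1
  | Turing.Dir.right => 1

variable {Q Γ : Type}

/-- The successor of a configuration, if there is one. -/
def step (M : DTM Q Γ) (c : Config Q Γ) : Option (Config Q Γ) :=
  (M.δ c.state (c.tape c.head)).map fun r =>
    { state := r.1
      tape := Function.update c.tape c.head r.2.1
      head := c.head + shift r.2.2 }

/-- The configuration reached after exactly `t` steps from `c`, if the machine makes that many. -/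
def stepN (M : DTM Q Γ) : ℕ → Config Q Γ → Option (Config Q Γ)
  | 0, c => some c
  | t + 1, c => (M.stepN t c).bind M.step

/-- The initial configuration on `w`: the cells `0, …, |w| - 1` hold `w`, all others are blank,
and the head scans the cell `0`. -/
def init (M : DTM Q Γ) (w : List Γ) : Config Q Γ where
  state := M.start
  tape := fun i => if 0 ≤ i then w.getD i.toNat M.blank else M.blank
  head := 0

/-- The computation on `w` reaches a halting configuration after at most `t` steps. -/
def HaltsWithin (M : DTM Q Γ) (w : List Γ) (t : ℕ) : Prop :=
  ∃ s ≤ t, ∃ c, M.stepN s (M.init w) = some c ∧ M.step c = none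

/-- The machine works in linear time: on every input string `w` its computation halts within
`K * |w| + C` steps, for constants `K` and `C` not depending on `w`. -/
def LinearTime (M : DTM Q Γ) : Prop :=
  ∃ K C : ℕ, ∀ w : List Γ, (∀ a ∈ w, a ∈ M.input) → M.HaltsWithin w (K * w.length + C)

/-- The machine is weight-reducing: for some partial order on the working alphabet,
each transition writes a symbol strictly smaller than the one it reads. -/
def WeightReducing (M : DTM Q Γ) : Prop :=
  ∃ P : PartialOrder Γ, ∀ p σ q τ d, M.δ p σ = some (q, τ, d) → P.lt τ σ

/-- Finite descriptions of machines: number of states, number of working symbols, blank symbol,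
membership vector of the input alphabet, transition table (rows indexed by states, columns by
symbols; `true` stands for a move to the right), initial state, membership vector of the set of
final states. -/
abbrev Code : Type :=
  ℕ × ℕ × ℕ × List Bool × List (List (Option (ℕ × ℕ × Bool))) × ℕ × List Bool

/-- The description of a machine with states `0, …, n - 1` and working symbols `0, …, g - 1`. -/
def encode {n g : ℕ} (M : DTM (Fin n) (Fin g)) : Code :=
  (n, g, M.blank.val,
    List.ofFn fun a : Fin g => decide (a ∈ M.input),
    List.ofFn fun p : Fin n => List.ofFn fun σ : Fin g =>
      (M.δ p σ).map fun r => (r.1.val, r.2.1.val, decide (r.2.2 = Turing.Dir.right)),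
    M.start.val,
    List.ofFn fun q : Fin n => decide (q ∈ M.final))

/-- The description determines the machine. -/
theorem encode_injective {n g : ℕ} :
    Function.Injective (encode : DTM (Fin n) (Fin g) → Code) := by
  intro M M' h
  obtain ⟨b, i, hb, δ, hw, s, f⟩ := M
  obtain ⟨b', i', hb', δ', hw', s', f'⟩ := M'
  simp only [encode, Prod.mk.injEq, List.ofFn_inj, true_and] at h
  obtain ⟨h1, h2, h3, h4, h5⟩ := h
  have e1 : b = b' := Fin.ext h1
  have e2 : i = i' := by ext a; simpa using congrFun h2 a
  have e4 : s = s' := Fin.ext h4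
  have e5 : f = f' := by ext a; simpa using congrFun h5 a
  have e3 : δ = δ' := by
    funext p σ
    have h := congrFun (List.ofFn_inj.1 (congrFun h3 p)) σ
    refine Option.map_injective ?_ h
    rintro ⟨q, τ, d⟩ ⟨q', τ', d'⟩ hr
    simp only [Prod.mk.injEq, Fin.val_inj] at hr
    obtain ⟨rfl, rfl, hd⟩ := hr
    cases d <;> cases d' <;> simp_all
  subst e1 e2 e3 e4 e5
  rfl

end DTM

/-! On a finite alphabet, weight reduction means that some rank `r : Γ → {0, …, g-1}` drops with
every transition, so no cell is read more than `g` times. A computation confined to a tape segment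
is therefore linear in the length of the segment, and the only way not to halt is to run off into
the blanks.

A segment influences the rest of the tape only through its reactions to successive entries of the
head. Truncated to `g` entries, these reactions range over a finite set of some size `N`, and the
truncation is compatible with prepending symbols (`behavior_cons`), since a cell `a` can send the
head onwards at most `r a` times. Two consequences follow by pigeonhole. The infinite blank tails
may be replaced by blank blocks of length at most `N`, whose behaviors are also those of arbitrarily
long blocks (`exists_periodic_blank`); so halting on `w` depends only on behaviors (`meets_spec`),
and a halting run takes at most `g * (|w| + 2N)` steps. Inputs longer than `N` can be shortened
without changing the behavior (`exists_shorter`).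

Hence linear time is equivalent to halting within that bound on all inputs of length at most `N`
(`linearTime_iff`). Since `N` is computable from the numbers of states and symbols, this is a
bounded search, as is the search for a rank; both are primitive recursive. -/

namespace DTM

open Turing

/-! ### Reactions of a tape segment to the head -/

section Behavior

variable {Q Γ : Type}

/-- The potential of a tape segment: an upper bound for the number of moves made inside it. -/
def potential (r : Γ → ℕ) (u : List Γ) : ℕ := (u.map fun a => r a + 1).sum

@[simp] theorem potential_nil (r : Γ → ℕ) : potential r [] = 0 := rfl

@[simp] theorem potential_cons (r : Γ → ℕ) (a : Γ) (u : List Γ) :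
    potential r (a :: u) = r a + 1 + potential r u := by simp [potential]

theorem potential_le {r : Γ → ℕ} {g : ℕ} (hr : ∀ a, r a < g) (u : List Γ) :
    potential r u ≤ g * u.length := by
  induction u with
  | nil => simp
  | cons a u ih => have := hr a; simp only [potential_cons, List.length_cons]; nlinarith

/-- The rank of the nearest cell of a segment, shifted so that the empty segment has rank `0`. -/
def headRank (r : Γ → ℕ) : List Γ → ℕ
  | [] => 0
  | a :: _ => r a + 1

/-- The reaction of a tape segment `u`, listed from its nearest cell outwards in direction `d`, to
the head entering its nearest cell in state `q`: `none` if the head leaves through the far end,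
`some none` if the machine halts inside, `some (some (q', u'))` if the head comes back in state
`q'` leaving the contents `u'`. -/
def respond (M : DTM Q Γ) (r : Γ → ℕ) (d : Dir) :
    List Γ → Q → Option (Option (Q × List Γ))
  | [], _ => none
  | a :: u, q =>
    match M.δ q a with
    | none => some none
    | some (q', τ, d') =>
      if d' = d then
        match respond M r d u q' with
        | none => none
        | some none => some none
        | some (some (q'', u')) =>
          -- The test is there for termination only; it always succeeds when `M` reduces `r`
          -- (`respond_turn`).
          if potential r (τ :: u') < potential r (a :: u) then respond M r d (τ :: u') q'' else none
      else some (some (q', τ :: u))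
  termination_by u => potential r u
  decreasing_by
    · simp
    · assumption

/-- The rank function `r` strictly decreases along transitions. -/
def Reduces (M : DTM Q Γ) (r : Γ → ℕ) : Prop :=
  ∀ p σ q τ d, M.δ p σ = some (q, τ, d) → r τ < r σ

variable {M : DTM Q Γ} {r : Γ → ℕ} {d : Dir}

theorem respond_nil (q : Q) : respond M r d [] q = none := by rw [respond]

theorem respond_halt {q : Q} {a : Γ} {u : List Γ} (h : M.δ q a = none) :
    respond M r d (a :: u) q = some none := by rw [respond, h]

theorem respond_exit {q q' : Q} {a τ : Γ} {d' : Dir} {u : List Γ}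
    (h : M.δ q a = some (q', τ, d')) (hd : d' ≠ d) :
    respond M r d (a :: u) q = some (some (q', τ :: u)) := by
  rw [respond, h]; simp [hd]

/-- The nearest cell is rewritten at least once before the head comes back out. The drop of
`potential` justifies the recursion of `respond`; the drop of `headRank` limits the number of
entries. -/
theorem potential_lt_of_respond (hr : M.Reduces r) {u : List Γ} {q q' : Q} {u' : List Γ}
    (h : respond M r d u q = some (some (q', u'))) :
    potential r u' < potential r u ∧ headRank r u' < headRank r u := by
  induction hn : potential r u using Nat.strong_induction_on generalizing u q q' u' with
  | _ n ih =>
    subst hn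
    cases u with
    | nil => simp [respond_nil] at h
    | cons a u =>
      rw [respond] at h
      cases hδ : M.δ q a with
      | none => simp [hδ] at h
      | some x =>
        obtain ⟨p, τ, d'⟩ := x
        have hτ := hr _ _ _ _ _ hδ
        simp only [hδ] at h
        split_ifs at h with hd
        · cases ho : respond M r d u p with
          | none => simp [ho] at h
          | some o =>
            rcases o with _ | ⟨p', v⟩
            · simp [ho] at h
            · simp only [ho] at h
              split_ifs at h with hlt
              have := ih _ hlt h rfl
              simp only [headRank] at this ⊢
              omega
        · simp only [Option.some.injEq, Prod.mk.injEq] at h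
          obtain ⟨rfl, rfl⟩ := h
          simp only [potential_cons, headRank]
          omega

theorem respond_turn (hr : M.Reduces r) {q q' : Q} {a τ : Γ} {u : List Γ}
    (h : M.δ q a = some (q', τ, d)) :
    respond M r d (a :: u) q =
      match respond M r d u q' with
      | none => none
      | some none => some none
      | some (some (q'', u')) => respond M r d (τ :: u') q'' := by
  rw [respond, h]
  cases ho : respond M r d u q' with
  | none => simp [ho]
  | some o =>
    rcases o with _ | ⟨p', v⟩
    · simp [ho]
    · have := (potential_lt_of_respond hr ho).1
      have hτ := hr _ _ _ _ _ h
      have hlt : potential r (τ :: v) < potential r (a :: u) := by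
        simp only [potential_cons]; omega
      simp [ho, hlt, -potential_cons]

/-- Induction along the evaluation of `respond`. -/
theorem respond_induction (hr : M.Reduces r)
    {P : List Γ → Q → Option (Option (Q × List Γ)) → Prop}
    (nil : ∀ q, P [] q none)
    (halt : ∀ q a u, M.δ q a = none → P (a :: u) q (some none))
    (exit : ∀ q a u q' τ d', M.δ q a = some (q', τ, d') → d' ≠ d →
      P (a :: u) q (some (some (q', τ :: u))))
    (through : ∀ q a u q' τ, M.δ q a = some (q', τ, d) → P u q' none → P (a :: u) q none)
    (halt_inside : ∀ q a u q' τ, M.δ q a = some (q', τ, d) → P u q' (some none) →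
      P (a :: u) q (some none))
    (back : ∀ q a u q' τ q'' u' o, M.δ q a = some (q', τ, d) → P u q' (some (some (q'', u'))) →
      P (τ :: u') q'' o → P (a :: u) q o)
    (u : List Γ) (q : Q) : P u q (respond M r d u q) := by
  induction hn : potential r u using Nat.strong_induction_on generalizing u q with
  | _ n ih =>
    subst hn
    cases u with
    | nil => rw [respond_nil]; exact nil q
    | cons a u =>
      cases hδ : M.δ q a with
      | none => rw [respond_halt hδ]; exact halt _ _ _ hδ
      | some x =>
        obtain ⟨p, τ, d'⟩ := x
        have hτ := hr _ _ _ _ _ hδ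
        by_cases hd : d' = d
        · subst hd
          rw [respond_turn hr hδ]
          have h1 := ih _ (by simp) u p rfl
          cases ho : respond M r d' u p with
          | none => rw [ho] at h1; exact through _ _ _ _ _ hδ h1
          | some o =>
            rw [ho] at h1
            rcases o with _ | ⟨p', v⟩
            · exact halt_inside _ _ _ _ _ hδ h1
            · have hv := (potential_lt_of_respond hr ho).1
              exact back _ _ _ _ _ _ _ _ hδ h1
                (ih _ (by simp only [potential_cons]; omega) _ _ rfl)
        · rw [respond_exit hδ hd]; exact exit _ _ _ _ _ _ hδ hd

/-! ### Reactions versus actual computations -/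

/-- The tape `t` holds the symbols of `u` from position `p` on in direction `d`. -/
def Matches (t : ℤ → Γ) (d : Dir) : ℤ → List Γ → Prop
  | _, [] => True
  | p, a :: u => t p = a ∧ Matches t d (p + shift d) u

theorem Matches.congr {t t' : ℤ → Γ} {p : ℤ} {u : List Γ} (h : Matches t d p u)
    (ht : ∀ k : ℕ, t' (p + k * shift d) = t (p + k * shift d)) : Matches t' d p u := by
  induction u generalizing p with
  | nil => trivial
  | cons a u ih =>
    refine ⟨by simpa using (ht 0).trans (by simpa using h.1), ih h.2 fun k => ?_⟩
    have := ht (k + 1)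
    push_cast at this
    rwa [show p + shift d + k * shift d = p + (k + 1) * shift d by ring]

theorem stepN_add (M : DTM Q Γ) {s t : ℕ} {c c' : Config Q Γ} (h : M.stepN s c = some c') :
    M.stepN (s + t) c = M.stepN t c' := by
  induction t with
  | zero => simpa [stepN] using h
  | succ t ih => rw [← add_assoc, stepN, ih, stepN]

theorem stepN_one (M : DTM Q Γ) (c : Config Q Γ) : M.stepN 1 c = M.step c := by simp [stepN]

theorem shift_of_ne {d d' : Dir} (h : d' ≠ d) : shift d' = -shift d := by
  cases d <;> cases d' <;> simp_all [shift]

/-- What `respond` says about the actual computation. -/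
def RespondSpec (M : DTM Q Γ) (r : Γ → ℕ) (d : Dir) (u : List Γ) (c : Config Q Γ) :
    Option (Option (Q × List Γ)) → Prop
  | none => ∃ t c', M.stepN t c = some c' ∧ c'.head = c.head + u.length * shift d
  | some none => ∃ t c', t ≤ potential r u ∧ M.stepN t c = some c' ∧ M.step c' = none
  | some (some (q', u')) => ∃ t c', t + potential r u' ≤ potential r u ∧ u'.length = u.length ∧
      M.stepN t c = some c' ∧ c'.state = q' ∧ c'.head = c.head - shift d ∧
      Matches c'.tape d c.head u' ∧
      ∀ k : ℕ, c'.tape (c.head - (k + 1) * shift d) = c.tape (c.head - (k + 1) * shift d)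

/-- An excursion that ends where it began can be put in front of a run: its `s` steps are paid for
by the potential lost on the way. -/
theorem respondSpec_of_stepN {u v : List Γ} {c c' : Config Q Γ} {s : ℕ}
    (h : M.stepN s c = some c') (hs : s + potential r v ≤ potential r u)
    (hl : v.length = u.length) (hp : c'.head = c.head)
    (ht : ∀ k : ℕ, c'.tape (c.head - (k + 1) * shift d) = c.tape (c.head - (k + 1) * shift d))
    {o : Option (Option (Q × List Γ))} (ho : RespondSpec M r d v c' o) :
    RespondSpec M r d u c o := by
  rcases o with _ | _ | ⟨q', u'⟩
  · obtain ⟨t, c'', h1, h2⟩ := ho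
    exact ⟨s + t, c'', by rw [stepN_add M h, h1], by rw [h2, hp, hl]⟩
  · obtain ⟨t, c'', h0, h1, h2⟩ := ho
    exact ⟨s + t, c'', by omega, by rw [stepN_add M h, h1], h2⟩
  · obtain ⟨t, c'', h0, hl', h1, h2, h3, h4, h5⟩ := ho
    rw [hp] at h3 h4 h5
    exact ⟨s + t, c'', by omega, by omega, by rw [stepN_add M h, h1], h2, h3, h4,
      fun k => (h5 k).trans (ht k)⟩

theorem respondSpec (hr : M.Reduces r) (u : List Γ) (q : Q) :
    ∀ c : Config Q Γ, c.state = q → Matches c.tape d c.head u →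
      RespondSpec M r d u c (respond M r d u q) := by
  refine respond_induction hr
    (P := fun u q o => ∀ c : Config Q Γ, c.state = q → Matches c.tape d c.head u →
      RespondSpec M r d u c o) ?_ ?_ ?_ ?_ ?_ ?_ u q
  · intro q c _ _
    exact ⟨0, c, rfl, by simp⟩
  · rintro q a u hδ c rfl ⟨rfl, -⟩
    exact ⟨0, c, by simp, rfl, by simp [step, hδ]⟩
  all_goals
    rintro q a u q' τ
  · rintro d' hδ hd c rfl ⟨rfl, hm⟩
    have hτ := hr _ _ _ _ _ hδ
    refine ⟨1, _, ?_, by simp, by rw [stepN_one, step, hδ]; rfl, rfl, ?_, ⟨by simp, ?_⟩, ?_⟩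
    · simp only [potential_cons]; omega
    · simp [shift_of_ne hd, sub_eq_add_neg]
    · refine hm.congr fun k => Function.update_of_ne ?_ _ _
      cases d <;> simp [shift] <;> omega
    · intro k
      refine Function.update_of_ne ?_ _ _
      cases d <;> simp [shift] <;> omega
  all_goals
    first
    | rintro hδ ih c rfl ⟨rfl, hm⟩
    | rintro q'' u' o hδ ih ih' c rfl ⟨rfl, hm⟩
    have hτ := hr _ _ _ _ _ hδ
    have hs : M.stepN 1 c = some ⟨q', Function.update c.tape c.head τ, c.head + shift d⟩ := by
      rw [stepN_one, step, hδ]; rfl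
    specialize ih ⟨q', Function.update c.tape c.head τ, c.head + shift d⟩ rfl (hm.congr (t' := Function.update c.tape c.head τ)
      fun k => Function.update_of_ne (by cases d <;> simp [shift] <;> omega) _ _)
  · obtain ⟨t, c', h1, h2⟩ := ih
    refine ⟨1 + t, c', by rw [stepN_add M hs, h1], ?_⟩
    rw [h2]; simp; ring
  · obtain ⟨t, c', h0, h1, h2⟩ := ih
    exact ⟨1 + t, c', by simp only [potential_cons]; omega, by rw [stepN_add M hs, h1], h2⟩
  · obtain ⟨t, c', h0, hl, h1, h2, h3, h4, h5⟩ := ih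
    -- The cell just written lies directly behind the inner segment, hence is untouched by the
    -- excursion: the case `k = 0` of the frame condition.
    have hcell : c'.tape c.head = τ := by simpa using h5 0
    have hhead : c'.head = c.head := by simpa using h3
    refine respondSpec_of_stepN (v := τ :: u') (s := 1 + t) (c' := c')
      (by rw [stepN_add M hs, h1]) (by simp only [potential_cons]; omega) (by simp [hl]) hhead ?_
      (ih' c' h2 (by rw [hhead]; exact ⟨hcell, h4⟩))
    intro k
    have h6 := h5 (k + 1)
    dsimp only at h6
    rw [show c.head + shift d - (((k + 1 : ℕ) : ℤ) + 1) * shift d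
      = c.head - (k + 1) * shift d by push_cast; ring] at h6
    rw [h6]
    exact Function.update_of_ne (by cases d <;> simp [shift] <;> omega) _ _

/-! ### Behaviors: finiteness and congruence -/

/-- The possible behaviors of a tape segment over the next `k` entries of the head. -/
def BehaviorType (Q : Type) : ℕ → Type
  | 0 => Unit
  | k + 1 => Q → Option (Option (Q × BehaviorType Q k))

/-- The number of behaviors of machines with `n` states over `k` entries of the head. -/
def behaviorCount (n : ℕ) : ℕ → ℕ
  | 0 => 1
  | k + 1 => (n * behaviorCount n k + 2) ^ n

instance [Finite Q] : ∀ k, Finite (BehaviorType Q k)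
  | 0 => inferInstanceAs (Finite Unit)
  | k + 1 =>
    have : Finite (BehaviorType Q k) := instFiniteBehaviorType k
    inferInstanceAs (Finite (Q → Option (Option (Q × BehaviorType Q k))))

/-- This makes the pigeonhole bound computable from a machine description. -/
theorem card_behaviorType [Finite Q] (k : ℕ) :
    Nat.card (BehaviorType Q k) = behaviorCount (Nat.card Q) k := by
  induction k with
  | zero => exact Nat.card_unique (α := Unit)
  | succ k ih =>
    change Nat.card (Q → Option (Option (Q × BehaviorType Q k))) = _
    rw [Nat.card_fun, Finite.card_option, Finite.card_option, Nat.card_prod, ih, behaviorCount]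

/-- The behavior of a tape segment over the next `k` entries of the head. -/
def behavior (M : DTM Q Γ) (r : Γ → ℕ) (d : Dir) : ∀ k, List Γ → BehaviorType Q k
  | 0, _ => ()
  | k + 1, u => fun q =>
    (respond M r d u q).map (Option.map fun x => (x.1, behavior M r d k x.2))

/-- Each passage from `a` into the rest uses up one entry of the inner segment, but also lowers the
rank of the cell. Thus agreement for `r a` inner entries suffices for any number `j` of outer ones,
and the induction is on the rank. -/
theorem behavior_cons (hr : M.Reduces r) {a : Γ} {u v : List Γ} {k : ℕ} (hk : r a ≤ k)
    (h : behavior M r d k u = behavior M r d k v) (j : ℕ) :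
    behavior M r d j (a :: u) = behavior M r d j (a :: v) := by
  induction hn : r a using Nat.strong_induction_on generalizing a u v k j with
  | _ n ih =>
    subst hn
    cases j with
    | zero => rfl
    | succ j =>
      funext q
      cases hδ : M.δ q a with
      | none => simp only [behavior, respond_halt hδ]
      | some x =>
        obtain ⟨p, τ, d'⟩ := x
        have hτ := hr _ _ _ _ _ hδ
        by_cases hd : d' = d
        · subst hd
          -- A transition out of `a` forces `r a > 0`, so `k` is positive.
          obtain ⟨k, rfl⟩ : ∃ k', k = k' + 1 := ⟨k - 1, by omega⟩
          have hp := congrFun h p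
          simp only [behavior] at hp ⊢
          rw [respond_turn hr hδ, respond_turn hr hδ]
          rcases hu : respond M r d' u p with _ | _ | ⟨p₁, u₁⟩ <;>
          rcases hv : respond M r d' v p with _ | _ | ⟨p₂, v₁⟩ <;>
          simp only [hu, hv, Option.map_none, Option.map_some, Option.some.injEq, reduceCtorEq,
            Prod.mk.injEq] at hp ⊢
          obtain ⟨rfl, hp⟩ := hp
          -- After the return both inner segments agree for one entry less, while the written symbol
          -- has smaller rank.
          exact congrFun (ih _ hτ (by omega) hp (j + 1) rfl) p₁
        · simp only [behavior, respond_exit hδ hd, Option.map_some]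
          rw [ih _ hτ (by omega) h j rfl]

theorem behavior_append (hr : M.Reduces r) {g : ℕ} (hg : ∀ a, r a < g) (w : List Γ)
    {u v : List Γ} (h : behavior M r d g u = behavior M r d g v) :
    behavior M r d g (w ++ u) = behavior M r d g (w ++ v) := by
  induction w with
  | nil => exact h
  | cons a w ih => exact behavior_cons hr (hg a).le ih g

/-! ### Two segments facing each other -/

/-- Whether a machine halts between two segments of given behaviors when the head enters the
right one in a given state. -/
def Meets : ∀ k, BehaviorType Q k → BehaviorType Q k → Q → Prop
  | 0, _, _, _ => False
  | k + 1, l, r, q =>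
    match r q with
    | none => False
    | some none => True
    | some (some (q', r')) =>
      match l q' with
      | none => False
      | some none => True
      | some (some (q'', l')) => Meets k l' r' q''

/-- Each return from the right segment lowers its `headRank`, so `k` rounds suffice to settle the
run. At `k = 0` the right segment is empty and the head is already past its end. -/
theorem meets_spec (hr : M.Reduces r) (k : ℕ) (u v : List Γ) (c : Config Q Γ)
    (hk : headRank r v ≤ k) (hu : Matches c.tape Dir.left (c.head - 1) u)
    (hv : Matches c.tape Dir.right c.head v) :
    (Meets k (behavior M r Dir.left k u) (behavior M r Dir.right k v) c.state →
      ∃ t c', t ≤ potential r u + potential r v ∧ M.stepN t c = some c' ∧ M.step c' = none) ∧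
    (¬ Meets k (behavior M r Dir.left k u) (behavior M r Dir.right k v) c.state →
      ∃ t c', M.stepN t c = some c' ∧
        (c'.head = c.head + v.length ∨ c'.head = c.head - 1 - u.length)) := by
  induction k generalizing u v c with
  | zero =>
    cases v with
    | cons a v => simp [headRank] at hk
    | nil => exact ⟨fun h => h.elim, fun _ => ⟨0, c, rfl, by simp⟩⟩
  | succ k ih =>
    have h1 := respondSpec hr v c.state c rfl hv
    simp only [Meets, behavior]
    rcases ho : respond M r Dir.right v c.state with _ | _ | ⟨q₁, v₁⟩
    · rw [ho] at h1
      obtain ⟨t, c', h1, h2⟩ := h1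
      exact ⟨fun h => by simp at h, fun _ => ⟨t, c', h1, Or.inl (by simpa [shift] using h2)⟩⟩
    · rw [ho] at h1
      obtain ⟨t, c', h0, h1, h2⟩ := h1
      exact ⟨fun _ => ⟨t, c', by omega, h1, h2⟩, fun h => by simp at h⟩
    rw [ho] at h1
    obtain ⟨t, c₁, h0, hl, h1, rfl, h3, h4, h5⟩ := h1
    simp only [shift, mul_one] at h3 h5
    have hv₁ := (potential_lt_of_respond hr ho).2
    have hu₁ : Matches c₁.tape Dir.left c₁.head u := by
      rw [h3]
      refine hu.congr fun k => ?_
      have := h5 k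
      simp only [shift]
      rwa [show c.head - 1 + (k : ℤ) * -1 = c.head - (k + 1) by ring]
    have h6 := respondSpec hr u c₁.state c₁ rfl hu₁
    simp only [Option.map_some]
    rcases ho' : respond M r Dir.left u c₁.state with _ | _ | ⟨q₂, u₁⟩
    · rw [ho'] at h6
      obtain ⟨t', c', h1', h2'⟩ := h6
      refine ⟨fun h => by simp at h, fun _ => ⟨t + t', c', by rw [stepN_add M h1, h1'], Or.inr ?_⟩⟩
      simp only [shift] at h2'
      rw [h2', h3]; ring
    · rw [ho'] at h6
      obtain ⟨t', c', h0', h1', h2'⟩ := h6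
      exact ⟨fun _ => ⟨t + t', c', by omega, by rw [stepN_add M h1, h1'], h2'⟩,
        fun h => by simp at h⟩
    rw [ho'] at h6
    obtain ⟨t', c₂, h0', hl', h1', rfl, h3', h4', h5'⟩ := h6
    simp only [shift] at h3' h5'
    have hc : c₂.head = c.head := by rw [h3', h3]; ring
    have h7 := ih u₁ v₁ c₂ (by omega) (by rwa [hc, ← h3]) (by
      rw [hc]
      refine h4.congr fun k => ?_
      have := h5' k
      simp only [shift]
      rwa [show c₁.head - ((k : ℤ) + 1) * -1 = c.head + k * 1 by rw [h3]; ring] at this)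
    simp only [Option.map_some]
    refine ⟨fun h => ?_, fun h => ?_⟩
    · obtain ⟨t'', c', ha, hb, hc⟩ := h7.1 h
      exact ⟨t + (t' + t''), c', by omega, by rw [stepN_add M h1, stepN_add M h1', hb], hc⟩
    · obtain ⟨t'', c', ha, hb⟩ := h7.2 h
      exact ⟨t + (t' + t''), c', by rw [stepN_add M h1, stepN_add M h1', ha],
        by rw [hl, hl', hc] at hb; exact hb⟩

/-! ### Pigeonhole and reduction to short inputs -/

theorem abs_head_le (M : DTM Q Γ) {t : ℕ} {c c' : Config Q Γ} (h : M.stepN t c = some c') :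
    |c'.head - c.head| ≤ t := by
  induction t generalizing c' with
  | zero => simp only [stepN, Option.some.injEq] at h; simp [h]
  | succ t ih =>
    simp only [stepN, Option.bind_eq_some_iff, step, Option.map_eq_some_iff] at h
    obtain ⟨c₁, h1, ⟨p, τ, d⟩, -, rfl⟩ := h
    have := ih h1
    rw [abs_le] at this ⊢
    push_cast
    cases d <;> simp only [shift] <;> omega

theorem le_of_halts (M : DTM Q Γ) {s t : ℕ} {c c₁ c₂ : Config Q Γ}
    (hs : M.stepN s c = some c₁) (h : M.step c₁ = none) (ht : M.stepN t c = some c₂) : t ≤ s := by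
  by_contra! hlt
  obtain ⟨e, rfl⟩ : ∃ e, t = s + (1 + e) := ⟨t - s - 1, by omega⟩
  rw [stepN_add M hs] at ht
  clear hlt
  induction e generalizing c₂ with
  | zero => simp [stepN, h] at ht
  | succ e ih =>
    rw [← add_assoc, stepN, Option.bind_eq_some_iff] at ht
    obtain ⟨c₃, h3, -⟩ := ht
    exact ih h3

theorem matches_init_left (M : DTM Q Γ) (w : List Γ) (m : ℕ) (p : ℤ) (hp : p < 0) :
    Matches (M.init w).tape Dir.left p (List.replicate m M.blank) := by
  induction m generalizing p with
  | zero => trivial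
  | succ m ih =>
    refine ⟨?_, ih _ (by simp only [shift]; omega)⟩
    simp [init, hp]

theorem matches_init_right (M : DTM Q Γ) (w : List Γ) (m : ℕ) :
    Matches (M.init w).tape Dir.right 0 (w ++ List.replicate m M.blank) := by
  have key : ∀ (v : List Γ) (p : ℕ),
      (∀ k, k < v.length → w.getD (p + k) M.blank = v.getD k M.blank) →
      Matches (M.init w).tape Dir.right p v := by
    intro v
    induction v with
    | nil => intros; trivial
    | cons a v ih =>
      intro p h
      refine ⟨by simpa [init] using h 0 (by simp), ?_⟩
      have := ih (p + 1) fun k hk => by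
        have := h (k + 1) (by simpa using hk)
        rwa [List.getD_cons_succ, ← add_assoc, add_right_comm] at this
      simpa [shift] using this
  refine mod_cast key _ 0 fun k hk => ?_
  rw [zero_add]
  simp only [List.getD_eq_getElem?_getD]
  rcases lt_or_ge k w.length with hw | hw
  · rw [List.getElem?_append_left hw]
  · rw [List.getElem?_append_right hw, List.getElem?_eq_none hw, List.getElem?_replicate]
    split_ifs <;> simp

/-- Each value determines the next, so one repetition makes the sequence periodic from `i` on with
period `j - i`. -/
theorem exists_far_eq {α : Type*} {f : ℕ → α} (hf : ∀ x y, f x = f y → f (x + 1) = f (y + 1))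
    {i j : ℕ} (hij : i < j) (h : f i = f j) (T : ℕ) : ∃ m > T, f m = f i := by
  have hf' : ∀ e x y, f x = f y → f (x + e) = f (y + e) := by
    intro e
    induction e with
    | zero => intro x y h; exact h
    | succ e ih => intro x y h; exact hf _ _ (ih x y h)
  induction T with
  | zero => exact ⟨j, by omega, h.symm⟩
  | succ T ih =>
    obtain ⟨m, hm, he⟩ := ih
    by_cases hmi : i ≤ m
    · refine ⟨m + (j - i), by omega, ?_⟩
      have := hf' (m - i) i j h
      rw [show i + (m - i) = m by omega, show j + (m - i) = m + (j - i) by omega] at this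
      rw [← this, he]
    · exact ⟨j, by omega, h.symm⟩

theorem exists_lt_le_eq {α : Type*} [Finite α] (f : ℕ → α) :
    ∃ i j, i < j ∧ j ≤ Nat.card α ∧ f i = f j := by
  have := Fintype.ofFinite α
  obtain ⟨x, y, hxy, h⟩ := Fintype.exists_ne_map_eq_of_card_lt
    (fun k : Fin (Nat.card α + 1) => f k) (by simp)
  rcases lt_or_gt_of_ne hxy with hlt | hlt
  · exact ⟨x, y, hlt, by omega, h⟩
  · exact ⟨y, x, hlt, by omega, h.symm⟩

variable [Finite Q]

/-- The short block serves for the time bound; the arbitrarily long ones with the same behavior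
imitate the infinite blank tail. -/
theorem exists_periodic_blank (hr : M.Reduces r) {g : ℕ} (hg : ∀ a, r a < g) (d : Dir) :
    ∃ i ≤ Nat.card (BehaviorType Q g), ∀ T, ∃ m > T,
      behavior M r d g (List.replicate m M.blank) = behavior M r d g (List.replicate i M.blank) := by
  obtain ⟨i, j, hij, hj, h⟩ :=
    exists_lt_le_eq fun m => behavior M r d g (List.replicate m M.blank)
  refine ⟨i, by omega, exists_far_eq (fun x y hxy => ?_) hij h⟩
  exact behavior_cons hr (hg _).le hxy g

theorem headRank_le {g : ℕ} (hg : ∀ a, r a < g) (u : List Γ) : headRank r u ≤ g := by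
  cases u with
  | nil => simp [headRank]
  | cons a u => exact hg a

/-- Two suffixes of `w` have the same behavior in front of `v`; cutting out the factor between them
changes nothing, by `behavior_append`. -/
theorem exists_shorter (hr : M.Reduces r) {g : ℕ} (hg : ∀ a, r a < g) (d : Dir) (v w : List Γ)
    (hw : Nat.card (BehaviorType Q g) < w.length) :
    ∃ w' : List Γ, w'.length < w.length ∧ (∀ a ∈ w', a ∈ w) ∧
      behavior M r d g (w' ++ v) = behavior M r d g (w ++ v) := by
  obtain ⟨i, j, hij, hj, h⟩ := exists_lt_le_eq fun m => behavior M r d g (w.drop m ++ v)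
  refine ⟨w.take i ++ w.drop j, ?_, ?_, ?_⟩
  · simp only [List.length_append, List.length_take, List.length_drop]; omega
  · intro a ha
    rcases List.mem_append.1 ha with ha | ha
    · exact List.mem_of_mem_take ha
    · exact List.mem_of_mem_drop ha
  · have := behavior_append hr hg (w.take i) h
    rw [← List.append_assoc, List.take_append_drop] at this
    rw [List.append_assoc, this]

/-- A weight-reducing machine works in linear time as soon as it halts quickly on short inputs. -/
theorem linearTime_iff (hr : M.Reduces r) {g : ℕ} (hg : ∀ a, r a < g) :
    M.LinearTime ↔ ∀ w : List Γ, w.length ≤ Nat.card (BehaviorType Q g) →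
      (∀ a ∈ w, a ∈ M.input) →
      M.HaltsWithin w (g * (w.length + 2 * Nat.card (BehaviorType Q g))) := by
  set N := Nat.card (BehaviorType Q g)
  obtain ⟨i, hi, hi'⟩ := exists_periodic_blank hr hg Dir.left
  obtain ⟨j, hj, hj'⟩ := exists_periodic_blank hr hg Dir.right
  set H : List Γ → Prop := fun w =>
    Meets g (behavior M r Dir.left g (List.replicate i M.blank))
      (behavior M r Dir.right g (w ++ List.replicate j M.blank)) M.start with hH
  have spec := fun (w : List Γ) (k m : ℕ) =>
    meets_spec hr g (List.replicate k M.blank) (w ++ List.replicate m M.blank) (M.init w)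
      (headRank_le hg _) (matches_init_left M w k _ (by simp [init])) (matches_init_right M w m)
  have halts : ∀ w T, M.HaltsWithin w T → H w := by
    rintro w T ⟨s, hs, c, h1, h2⟩
    -- With padding longer than `T`, a run of at most `T` steps cannot leave the padded segment,
    -- which it would do if `Meets` failed.
    obtain ⟨k, hk, hk'⟩ := hi' T
    obtain ⟨m, hm, hm'⟩ := hj' T
    rw [hH]
    dsimp only
    rw [← hk', ← behavior_append hr hg w hm']
    by_contra hn
    obtain ⟨t, c', h3, h4⟩ := (spec w k m).2 hn
    have h5 := le_of_halts M h1 h2 h3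
    have h6 := abs_le.1 (abs_head_le M h3)
    simp only [init, List.length_append, List.length_replicate, Nat.cast_add] at h4 h6
    omega
  have bound : ∀ w, H w → M.HaltsWithin w (g * (w.length + 2 * N)) := by
    intro w h
    obtain ⟨t, c, h1, h2, h3⟩ := (spec w i j).1 h
    refine ⟨t, h1.trans ?_, c, h2, h3⟩
    refine (add_le_add (potential_le hg _) (potential_le hg _)).trans ?_
    rw [← mul_add]
    refine Nat.mul_le_mul_left g ?_
    simp only [List.length_append, List.length_replicate]
    omega
  constructor
  · rintro ⟨K, C, h⟩ w - hw
    exact bound w (halts w _ (h w hw))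
  · intro h
    have all : ∀ n (w : List Γ), w.length = n → (∀ a ∈ w, a ∈ M.input) → H w := by
      intro n
      induction n using Nat.strong_induction_on with
      | _ n ih =>
        rintro w rfl hw
        rcases le_or_gt w.length N with hl | hl
        · exact halts w _ (h w hl hw)
        · obtain ⟨w', h1, h2, h3⟩ := exists_shorter hr hg Dir.right (List.replicate j M.blank) w hl
          have := ih _ h1 w' rfl fun a ha => hw a (h2 a ha)
          rw [hH] at this ⊢
          dsimp only at this ⊢
          rwa [h3] at this
    -- The potential of `w` padded by two blank blocks of length at most `N` yields both constants.
    refine ⟨g, g * (2 * N), fun w hw => ?_⟩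
    rw [← mul_add]
    exact bound w (all _ w rfl hw)

end Behavior

end DTM

/-! ### Primitive recursive bounded quantifiers and counting -/

section PrimrecQuantifiers

variable {α β : Type*} [Primcodable α] [Primcodable β]

theorem PrimrecPred.forall_mem {f : α → List β} {p : α → β → Prop} (hf : Primrec f)
    (hp : PrimrecPred fun x : β × α => p x.2 x.1) : PrimrecPred fun a => ∀ b ∈ f a, p a b :=
  (PrimrecRel.forall_mem_list (R := fun b a => p a b) hp).comp hf Primrec.id

theorem PrimrecPred.exists_mem {f : α → List β} {p : α → β → Prop} (hf : Primrec f)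
    (hp : PrimrecPred fun x : β × α => p x.2 x.1) : PrimrecPred fun a => ∃ b ∈ f a, p a b :=
  (PrimrecRel.exists_mem_list (R := fun b a => p a b) hp).comp hf Primrec.id

theorem PrimrecPred.forall_lt_of {f : α → ℕ} {p : α → ℕ → Prop} (hf : Primrec f)
    (hp : PrimrecPred fun x : ℕ × α => p x.2 x.1) : PrimrecPred fun a => ∀ b < f a, p a b :=
  (PrimrecPred.forall_mem (Primrec.list_range.comp hf) hp).of_eq fun a => by simp

end PrimrecQuantifiers

namespace DTM

/-- All lists of length `k` with entries below `g`. -/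
def words (g : ℕ) : ℕ → List (List ℕ)
  | 0 => [[]]
  | k + 1 => (words g k).flatMap fun w => (List.range g).map fun a => a :: w

theorem mem_words {g k : ℕ} {w : List ℕ} : w ∈ words g k ↔ w.length = k ∧ ∀ a ∈ w, a < g := by
  induction k generalizing w with
  | zero => simp +contextual [words]
  | succ k ih =>
    cases w with
    | nil => simp [words]
    | cons a w => simp [words, ih]; tauto

theorem primrec_words : Primrec₂ words := by
  have hstep : Primrec₂ fun (g : ℕ) (x : ℕ × List (List ℕ)) =>
      x.2.flatMap fun w => (List.range g).map fun a => a :: w := by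
    refine Primrec.list_flatMap (Primrec.snd.comp Primrec.snd) ?_
    refine Primrec.list_map (Primrec.list_range.comp (Primrec.fst.comp Primrec.fst)) ?_
    exact Primrec.list_cons.comp Primrec.snd (Primrec.snd.comp Primrec.fst)
  refine (Primrec.nat_rec (f := fun _ : ℕ => [([] : List ℕ)]) (Primrec.const _) hstep).of_eq ?_
  intro g k
  induction k with
  | zero => rfl
  | succ k ih => simp only [words, ← ih]

theorem primrec_behaviorCount : Primrec₂ behaviorCount := by
  have hpow : Primrec₂ ((· ^ ·) : ℕ → ℕ → ℕ) := Primrec₂.unpaired'.1 Nat.Primrec.pow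
  have hstep : Primrec₂ fun (n : ℕ) (x : ℕ × ℕ) => (n * x.2 + 2) ^ n :=
    hpow.comp (Primrec.nat_add.comp (Primrec.nat_mul.comp Primrec.fst
      (Primrec.snd.comp Primrec.snd)) (Primrec.const 2)) Primrec.fst
  refine (Primrec.nat_rec (f := fun _ : ℕ => 1) (Primrec.const _) hstep).of_eq ?_
  intro n k
  induction k with
  | zero => rfl
  | succ k ih => simp only [behaviorCount, ← ih]

/-! ### Primitive recursive predicates on descriptions -/

namespace Code

/-- The number of states. -/
def states (c : Code) : ℕ := c.1
/-- The number of working symbols. -/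
def symbols (c : Code) : ℕ := c.2.1
/-- The blank symbol. -/
def blank (c : Code) : ℕ := c.2.2.1
/-- The membership vector of the input alphabet. -/
def input (c : Code) : List Bool := c.2.2.2.1
/-- The transition table. -/
def table (c : Code) : List (List (Option (ℕ × ℕ × Bool))) := c.2.2.2.2.1
/-- The initial state. -/
def start (c : Code) : ℕ := c.2.2.2.2.2.1
/-- The membership vector of the set of final states. -/
def final (c : Code) : List Bool := c.2.2.2.2.2.2

theorem primrec_states : Primrec states := Primrec.fst
theorem primrec_symbols : Primrec symbols := Primrec.fst.comp Primrec.snd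
theorem primrec_blank : Primrec blank := Primrec.fst.comp (Primrec.snd.comp Primrec.snd)
theorem primrec_input : Primrec input :=
  Primrec.fst.comp (Primrec.snd.comp (Primrec.snd.comp Primrec.snd))
theorem primrec_table : Primrec table :=
  Primrec.fst.comp (Primrec.snd.comp (Primrec.snd.comp (Primrec.snd.comp Primrec.snd)))
theorem primrec_start : Primrec start := Primrec.fst.comp
  (Primrec.snd.comp (Primrec.snd.comp (Primrec.snd.comp (Primrec.snd.comp Primrec.snd))))
theorem primrec_final : Primrec final := Primrec.snd.comp
  (Primrec.snd.comp (Primrec.snd.comp (Primrec.snd.comp (Primrec.snd.comp Primrec.snd))))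

/-- The format of the description of a machine. -/
def Valid (c : Code) : Prop :=
  blank c < symbols c ∧ (input c).length = symbols c ∧ (input c)[blank c]? = some false ∧
  (table c).length = states c ∧
  (∀ row ∈ table c, row.length = symbols c ∧ ∀ o ∈ row, ∀ e ∈ o.toList,
    e.1 < states c ∧ e.2.1 < symbols c ∧ e.2.1 ≠ blank c) ∧
  start c < states c ∧ (final c).length = states c

theorem primrecPred_valid : PrimrecPred Valid := by
  refine (Primrec.nat_lt.comp primrec_blank primrec_symbols).and <|
    (Primrec.eq.comp (Primrec.list_length.comp primrec_input) primrec_symbols).and <|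
    (Primrec.eq.comp (Primrec.list_getElem?.comp primrec_input primrec_blank)
      (Primrec.const _)).and <|
    (Primrec.eq.comp (Primrec.list_length.comp primrec_table) primrec_states).and <|
    PrimrecPred.and ?_ <|
    (Primrec.nat_lt.comp primrec_start primrec_states).and
    (Primrec.eq.comp (Primrec.list_length.comp primrec_final) primrec_states)
  refine PrimrecPred.forall_mem primrec_table (PrimrecPred.and
    (Primrec.eq.comp (Primrec.list_length.comp Primrec.fst) (primrec_symbols.comp Primrec.snd)) ?_)
  refine PrimrecPred.forall_mem Primrec.fst
    (PrimrecPred.forall_mem (Primrec.optionToList.comp Primrec.fst) ?_)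
  have hc : Primrec fun x : (ℕ × ℕ × Bool) × Option (ℕ × ℕ × Bool) ×
      List (Option (ℕ × ℕ × Bool)) × Code => x.2.2.2 :=
    Primrec.snd.comp (Primrec.snd.comp Primrec.snd)
  have he : Primrec fun x : (ℕ × ℕ × Bool) × Option (ℕ × ℕ × Bool) ×
      List (Option (ℕ × ℕ × Bool)) × Code => x.1.2.1 :=
    Primrec.fst.comp (Primrec.snd.comp Primrec.fst)
  exact (Primrec.nat_lt.comp (Primrec.fst.comp Primrec.fst) (primrec_states.comp hc)).and <|
    (Primrec.nat_lt.comp he (primrec_symbols.comp hc)).and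
    (PrimrecPred.not (Primrec.eq.comp he (primrec_blank.comp hc)))

/-- The existence of a ranking of the symbols that decreases along all transitions. -/
def Ranked (c : Code) : Prop :=
  ∃ ρ ∈ words (symbols c) (symbols c), ∀ row ∈ table c, ∀ a < symbols c,
    ∀ e ∈ (row.getD a none).toList, ρ.getD e.2.1 0 < ρ.getD a 0

theorem primrecPred_ranked : PrimrecPred Ranked := by
  refine PrimrecPred.exists_mem (primrec_words.comp primrec_symbols primrec_symbols) ?_
  refine PrimrecPred.forall_mem (primrec_table.comp Primrec.snd) ?_
  refine PrimrecPred.forall_lt_of (primrec_symbols.comp (Primrec.snd.comp Primrec.snd)) ?_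
  refine PrimrecPred.forall_mem (Primrec.optionToList.comp
    ((Primrec.list_getD none).comp (Primrec.fst.comp Primrec.snd) Primrec.fst)) ?_
  have hρ : Primrec fun x : (ℕ × ℕ × Bool) × ℕ × List (Option (ℕ × ℕ × Bool)) ×
      List ℕ × Code => x.2.2.2.1 :=
    Primrec.fst.comp (Primrec.snd.comp (Primrec.snd.comp Primrec.snd))
  exact Primrec.nat_lt.comp
    ((Primrec.list_getD 0).comp hρ (Primrec.fst.comp (Primrec.snd.comp Primrec.fst)))
    ((Primrec.list_getD 0).comp hρ (Primrec.fst.comp Primrec.snd))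

/-- One step on a configuration given by the state, the reversed contents of the tape to the left
of the head, and the contents of the tape from the head on. -/
def next (c : Code) (z : ℕ × List ℕ × List ℕ) : Option (ℕ × List ℕ × List ℕ) :=
  (((table c).getD z.1 []).getD (z.2.2.head?.getD (blank c)) none).map fun e =>
    if e.2.2 = true then (e.1, e.2.1 :: z.2.1, z.2.2.tail)
    else (e.1, z.2.1.tail, z.2.1.head?.getD (blank c) :: e.2.1 :: z.2.2.tail)

theorem primrec_next : Primrec₂ next := by
  have hz : Primrec fun x : Code × ℕ × List ℕ × List ℕ => x.2.2.2 :=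
    Primrec.snd.comp (Primrec.snd.comp Primrec.snd)
  refine Primrec.option_map ((Primrec.list_getD none).comp
    ((Primrec.list_getD []).comp (primrec_table.comp Primrec.fst) (Primrec.fst.comp Primrec.snd))
    (Primrec.option_getD.comp (Primrec.list_head?.comp hz) (primrec_blank.comp Primrec.fst))) ?_
  have hc : Primrec fun x : (Code × ℕ × List ℕ × List ℕ) × ℕ × ℕ × Bool => x.1.1 :=
    Primrec.fst.comp Primrec.fst
  have hl : Primrec fun x : (Code × ℕ × List ℕ × List ℕ) × ℕ × ℕ × Bool => x.1.2.2.1 :=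
    Primrec.fst.comp (Primrec.snd.comp (Primrec.snd.comp Primrec.fst))
  have hr : Primrec fun x : (Code × ℕ × List ℕ × List ℕ) × ℕ × ℕ × Bool => x.1.2.2.2 :=
    hz.comp Primrec.fst
  have hq : Primrec fun x : (Code × ℕ × List ℕ × List ℕ) × ℕ × ℕ × Bool => x.2.1 :=
    Primrec.fst.comp Primrec.snd
  have hτ : Primrec fun x : (Code × ℕ × List ℕ × List ℕ) × ℕ × ℕ × Bool => x.2.2.1 :=
    Primrec.fst.comp (Primrec.snd.comp Primrec.snd)
  have hd : Primrec fun x : (Code × ℕ × List ℕ × List ℕ) × ℕ × ℕ × Bool => x.2.2.2 :=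
    Primrec.snd.comp (Primrec.snd.comp Primrec.snd)
  exact Primrec.ite (Primrec.eq.comp hd (Primrec.const true))
    (hq.pair ((Primrec.list_cons.comp hτ hl).pair (Primrec.list_tail.comp hr)))
    (hq.pair ((Primrec.list_tail.comp hl).pair (Primrec.list_cons.comp
      (Primrec.option_getD.comp (Primrec.list_head?.comp hl) (primrec_blank.comp hc))
      (Primrec.list_cons.comp hτ (Primrec.list_tail.comp hr)))))

/-- The described machine halts on `w` within `t` steps. -/
def Halts (c : Code) (w : List ℕ) (t : ℕ) : Prop :=
  next c ((fun z => (next c z).getD z)^[t] (start c, [], w)) = none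

theorem primrecPred_halts : PrimrecPred fun x : Code × List ℕ × ℕ => Halts x.1 x.2.1 x.2.2 := by
  refine Primrec.eq.comp (primrec_next.comp Primrec.fst (Primrec.nat_iterate
    (Primrec.snd.comp Primrec.snd) (Primrec.pair (primrec_start.comp Primrec.fst)
      (Primrec.pair (Primrec.const []) (Primrec.fst.comp Primrec.snd))) ?_)) (Primrec.const none)
  exact Primrec.option_getD.comp
    (primrec_next.comp (Primrec.fst.comp Primrec.fst) Primrec.snd) Primrec.snd

/-- The number of behaviors of tape segments of the described machine. -/
def behaviors (c : Code) : ℕ := behaviorCount (states c) (symbols c)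

theorem primrec_behaviors : Primrec behaviors :=
  primrec_behaviorCount.comp primrec_states primrec_symbols

/-- The described machine halts quickly on all short inputs. -/
def HaltsOnShort (c : Code) : Prop :=
  ∀ k < behaviors c + 1, ∀ w ∈ words (symbols c) k,
    ¬ (∀ a ∈ w, (input c).getD a false = true) ∨
      Halts c w (symbols c * (w.length + 2 * behaviors c))

theorem primrecPred_haltsOnShort : PrimrecPred HaltsOnShort := by
  refine PrimrecPred.forall_lt_of (Primrec.succ.comp primrec_behaviors) ?_
  refine PrimrecPred.forall_mem (primrec_words.comp (primrec_symbols.comp Primrec.snd)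
    Primrec.fst) ?_
  have hc : Primrec fun x : List ℕ × ℕ × Code => x.2.2 := Primrec.snd.comp Primrec.snd
  refine PrimrecPred.or (PrimrecPred.not (PrimrecPred.forall_mem Primrec.fst ?_)) ?_
  · exact Primrec.eq.comp ((Primrec.list_getD false).comp
      (primrec_input.comp (hc.comp Primrec.snd)) Primrec.fst) (Primrec.const true)
  · refine primrecPred_halts.comp (f := fun x : List ℕ × ℕ × Code => (x.2.2, x.1,
      symbols x.2.2 * (x.1.length + 2 * behaviors x.2.2))) ?_
    exact hc.pair (Primrec.fst.pair (Primrec.nat_mul.comp (primrec_symbols.comp hc)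
      (Primrec.nat_add.comp (Primrec.list_length.comp Primrec.fst)
        (Primrec.nat_mul.comp (Primrec.const 2) (primrec_behaviors.comp hc)))))

end Code

end DTM

/-! ### Descriptions versus machines -/

namespace DTM

open Turing

theorem Reduces.weightReducing {Q Γ : Type} {M : DTM Q Γ} {r : Γ → ℕ} (h : M.Reduces r) :
    M.WeightReducing :=
  ⟨{ le := fun a b => a = b ∨ r a < r b
     le_refl := fun a => Or.inl rfl
     le_trans := by
      rintro a b c (rfl | h1) (rfl | h2)
      · exact Or.inl rfl
      · exact Or.inr h2
      · exact Or.inr h1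
      · exact Or.inr (h1.trans h2)
     le_antisymm := by
      rintro a b (rfl | h1) (h2 | h2)
      · rfl
      · rfl
      · exact h2.symm
      · exact absurd h1 h2.asymm
     lt := fun a b => r a < r b
     lt_iff_le_not_ge := by
      intro a b
      constructor
      · intro h
        refine ⟨Or.inr h, ?_⟩
        rintro (rfl | h')
        · exact lt_irrefl _ h
        · exact h.asymm h'
      · rintro ⟨rfl | h1, h2⟩
        · exact absurd (Or.inl rfl) h2
        · exact h1 }, h⟩

/-- Rank a symbol by the number of symbols strictly below it; it does not count itself, so the rank
stays below `g`. -/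
theorem WeightReducing.exists_rank {Q : Type} {g : ℕ} {M : DTM Q (Fin g)}
    (h : M.WeightReducing) : ∃ r : Fin g → ℕ, M.Reduces r ∧ ∀ a, r a < g := by
  classical
  obtain ⟨P, hP⟩ := h
  refine ⟨fun a => (Finset.univ.filter fun b => P.lt b a).card, fun p σ q τ d hδ => ?_,
    fun a => ?_⟩
  · have hlt := hP p σ q τ d hδ
    refine Finset.card_lt_card (Finset.ssubset_iff_of_subset ?_ |>.2 ⟨τ, ?_, ?_⟩)
    · intro b hb
      simp only [Finset.mem_filter, Finset.mem_univ, true_and] at hb ⊢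
      exact @lt_trans _ P.toPreorder _ _ _ hb hlt
    · simpa using hlt
    · simp
  · have : (Finset.univ.filter fun b => P.lt b a) ⊂ Finset.univ :=
      Finset.ssubset_iff_of_subset (Finset.subset_univ _) |>.2 ⟨a, Finset.mem_univ a, by simp⟩
    simpa using Finset.card_lt_card this

/-- The entry of the transition table that describes the transition `r`. -/
def entry {n g : ℕ} (r : Fin n × Fin g × Dir) : ℕ × ℕ × Bool :=
  (r.1.val, r.2.1.val, decide (r.2.2 = Dir.right))

namespace Code

theorem getD_table {n g : ℕ} (M : DTM (Fin n) (Fin g)) (p : Fin n) (a : Fin g) :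
    ((table M.encode).getD p []).getD a none = (M.δ p a).map entry := by
  simp [table, encode]
  rfl

theorem mem_table {n g : ℕ} (M : DTM (Fin n) (Fin g)) {row : List (Option (ℕ × ℕ × Bool))} :
    row ∈ table M.encode ↔ ∃ p : Fin n, row = List.ofFn fun a : Fin g => (M.δ p a).map entry := by
  rw [table, encode, List.mem_ofFn]
  exact ⟨fun ⟨p, h⟩ => ⟨p, h.symm⟩, fun ⟨p, h⟩ => ⟨p, h.symm⟩⟩

theorem valid_encode {n g : ℕ} (M : DTM (Fin n) (Fin g)) : Valid M.encode := by
  refine ⟨M.blank.2, by simp [input, symbols, encode], ?_, by simp [table, states, encode], ?_,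
    M.start.2, by simp [final, states, encode]⟩
  · simp [input, blank, encode, M.blank_notMem_input]
  · intro row hrow
    obtain ⟨p, rfl⟩ := (mem_table M).1 hrow
    refine ⟨by simp [symbols, encode], ?_⟩
    intro o ho e he
    obtain ⟨a, rfl⟩ := List.mem_ofFn.1 ho
    simp only [Option.mem_toList, Option.map_eq_some_iff] at he
    obtain ⟨⟨q, τ, d⟩, hδ, rfl⟩ := he
    exact ⟨q.2, τ.2, fun h => M.blank_not_written _ _ _ _ _ hδ (Fin.ext h)⟩

/-- The transition described by an entry of the transition table. -/
def decodeEntry (n g : ℕ) (e : ℕ × ℕ × Bool) : Option (Fin n × Fin g × Dir) :=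
  if h : e.1 < n ∧ e.2.1 < g then
    some (⟨e.1, h.1⟩, ⟨e.2.1, h.2⟩, if e.2.2 = true then Dir.right else Dir.left)
  else none

/-- Validity makes every range check of `decodeEntry` succeed, so decoding the table entry by entry
loses nothing. -/
theorem exists_encode_eq {c : Code} (h : Valid c) :
    ∃ (n g : ℕ) (M : DTM (Fin n) (Fin g)), M.encode = c := by
  obtain ⟨n, g, b, inp, tbl, s, fin⟩ := c
  obtain ⟨hb, hi, hbi, ht, hrow, hs, hf⟩ := h
  simp only [states, symbols, blank, input, table, start, final] at *
  subst hi ht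
  refine ⟨_, _,
    { blank := ⟨b, hb⟩
      input := Finset.univ.filter fun a : Fin inp.length => inp[a] = true
      blank_notMem_input := ?_
      δ := fun p a => ((tbl[p])[(a : ℕ)]?.getD none).bind (decodeEntry tbl.length inp.length)
      blank_not_written := ?_
      start := ⟨s, hs⟩
      final := Finset.univ.filter fun q : Fin tbl.length => fin[(q : ℕ)]? = some true }, ?_⟩
  · rw [List.getElem?_eq_getElem hb, Option.some.injEq] at hbi
    simp [hbi]
  · intro p a q τ d h
    obtain ⟨hl, hrow⟩ := hrow tbl[p] (List.getElem_mem _)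
    rw [List.getElem?_eq_getElem (by omega), Option.getD_some, Option.bind_eq_some_iff] at h
    obtain ⟨e, he, h⟩ := h
    have := hrow _ (List.getElem_mem (by omega : (a : ℕ) < tbl[p].length)) e (by simpa using he)
    simp only [decodeEntry, this.1, this.2.1, and_self, dite_true, Option.some.injEq,
      Prod.mk.injEq] at h
    obtain ⟨-, rfl, -⟩ := h
    exact fun h => this.2.2 (Fin.val_eq_of_eq h)
  · simp only [encode, Prod.mk.injEq, true_and]
    refine ⟨?_, ?_, ?_⟩
    · refine List.ext_getElem (by simp) fun k _ _ => ?_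
      simp
    · refine List.ext_getElem (by simp) fun k _ hk => ?_
      obtain ⟨hl, hrow⟩ := hrow tbl[k] (List.getElem_mem _)
      refine List.ext_getElem (by simp [hl]) fun j _ hj => ?_
      simp only [List.getElem_ofFn, Fin.getElem_fin, List.getElem?_eq_getElem hj, Option.getD_some]
      have := hrow _ (List.getElem_mem hj)
      cases ho : tbl[k][j] with
      | none => simp
      | some e =>
        have := this e (by simp [ho])
        simp only [Option.bind_some, decodeEntry, this.1, this.2.1, and_self, dite_true,
          Option.map_some]
        rcases e with ⟨q, τ, _ | _⟩ <;> simp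
    · refine List.ext_getElem (by simp [hf]) fun k _ hk => ?_
      simp [List.getElem?_eq_getElem hk]

theorem valid_iff (c : Code) : Valid c ↔ ∃ (n g : ℕ) (M : DTM (Fin n) (Fin g)), M.encode = c :=
  ⟨exists_encode_eq, by rintro ⟨n, g, M, rfl⟩; exact valid_encode M⟩

/-- The search over words of length `g` with entries below `g` is exhaustive enough because of
`exists_rank`. -/
theorem ranked_encode {n g : ℕ} (M : DTM (Fin n) (Fin g)) :
    Ranked M.encode ↔ M.WeightReducing := by
  have hg : symbols M.encode = g := rfl
  constructor
  · rintro ⟨ρ, -, h⟩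
    refine Reduces.weightReducing (r := fun a => ρ.getD a 0) fun p a q τ d hδ => ?_
    refine h _ ((mem_table M).2 ⟨p, rfl⟩) a a.2 (entry (q, τ, d)) ?_
    simp [hδ]
  · intro h
    obtain ⟨r, hr, hrg⟩ := h.exists_rank
    refine ⟨List.ofFn r, mem_words.2 ⟨by simp [hg], ?_⟩, ?_⟩
    · intro a ha
      obtain ⟨k, rfl⟩ := List.mem_ofFn.1 ha
      exact hrg k
    · intro row hrow a ha e he
      obtain ⟨p, rfl⟩ := (mem_table M).1 hrow
      rw [hg] at ha
      lift a to Fin g using ha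
      simp only [List.getD_eq_getElem?_getD, List.getElem?_ofFn, a.2, dite_true, Option.getD_some,
        Option.mem_toList, Option.map_eq_some_iff] at he
      obtain ⟨⟨q, τ, d⟩, hδ, rfl⟩ := he
      simpa [entry] using hr _ _ _ _ _ hδ

/-- The list data `z` represent the configuration `x` up to a translation of the tape. -/
def Represents {n g : ℕ} (b : ℕ) (x : Config (Fin n) (Fin g)) (z : ℕ × List ℕ × List ℕ) : Prop :=
  z.1 = x.state ∧ (∀ k : ℕ, (x.tape (x.head + k) : ℕ) = z.2.2.getD k b) ∧
    ∀ k : ℕ, (x.tape (x.head - 1 - k) : ℕ) = z.2.1.getD k b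

theorem head?_getD {α : Type*} (l : List α) (b : α) : l.head?.getD b = l.getD 0 b := by
  cases l <;> simp

theorem tail_getD {α : Type*} (l : List α) (b : α) (k : ℕ) :
    l.tail.getD k b = l.getD (k + 1) b := by
  cases l <;> simp

theorem next_represents {n g : ℕ} (M : DTM (Fin n) (Fin g)) {x : Config (Fin n) (Fin g)}
    {z : ℕ × List ℕ × List ℕ} (h : Represents M.blank x z) :
    (M.step x = none ∧ next M.encode z = none) ∨
      ∃ x' z', M.step x = some x' ∧ next M.encode z = some z' ∧ Represents M.blank x' z' := by
  obtain ⟨q, l, r⟩ := z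
  obtain ⟨hq, hr, hl⟩ := h
  dsimp only at hq hr hl
  subst hq
  have hb : blank M.encode = M.blank := rfl
  have ha : r.head?.getD M.blank = (x.tape x.head : ℕ) := by
    rw [head?_getD, ← hr 0]; simp
  simp only [next, step, hb, ha, getD_table]
  rcases hδ : M.δ x.state (x.tape x.head) with _ | ⟨q, τ, d⟩
  · simp
  refine Or.inr ⟨_, _, rfl, rfl, ?_⟩
  cases d
  · refine ⟨rfl, fun k => ?_, fun k => ?_⟩ <;>
      simp only [shift, entry, reduceCtorEq, decide_false, Bool.false_eq_true, if_false]
    · rcases k with _ | _ | k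
      · rw [head?_getD, ← hl 0, Function.update_of_ne (by simp)]
        simp [sub_eq_add_neg]
      · simp
      · rw [List.getD_cons_succ, List.getD_cons_succ, tail_getD, ← hr,
          Function.update_of_ne (by push_cast; omega)]
        congr 2; push_cast; ring
    · rw [tail_getD, ← hl, Function.update_of_ne (by omega)]
      congr 2; push_cast; ring
  · refine ⟨rfl, fun k => ?_, fun k => ?_⟩ <;>
      simp only [shift, entry, decide_true, if_true]
    · rw [tail_getD, ← hr, Function.update_of_ne (by omega)]
      congr 2; push_cast; ring
    · rcases k with _ | k
      · simp
      · rw [List.getD_cons_succ, ← hl, Function.update_of_ne (by push_cast; omega)]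
        congr 2; push_cast; ring

theorem represents_init {n g : ℕ} (M : DTM (Fin n) (Fin g)) (w : List (Fin g)) :
    Represents M.blank (M.init w) (start M.encode, [], w.map Fin.val) := by
  refine ⟨rfl, fun k => ?_, fun k => ?_⟩
  · simp only [init, zero_add, Nat.cast_nonneg, if_true, Int.toNat_natCast, List.getD_map]
  · have : ¬ (0 : ℤ) ≤ 0 - 1 - k := by omega
    simp only [init, this, if_false, List.getD_nil]

theorem halts_encode {n g : ℕ} (M : DTM (Fin n) (Fin g)) (w : List (Fin g)) (t : ℕ) :
    Halts M.encode (w.map Fin.val) t ↔ M.HaltsWithin w t := by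
  -- The iterated map is stationary once the machine has halted, so `t` iterations represent the
  -- configuration after `s ≤ t` steps, with `s < t` only after halting.
  have key : ∃ s ≤ t, ∃ x, M.stepN s (M.init w) = some x ∧ (s = t ∨ M.step x = none) ∧
      Represents M.blank x ((fun z => (next M.encode z).getD z)^[t]
        (start M.encode, [], w.map Fin.val)) := by
    induction t with
    | zero => exact ⟨0, le_rfl, _, rfl, Or.inl rfl, represents_init M w⟩
    | succ t ih =>
      obtain ⟨s, hs, x, h1, h2, h3⟩ := ih
      rw [Function.iterate_succ_apply']
      rcases next_represents M h3 with ⟨h4, h5⟩ | ⟨x', z', h4, h5, h6⟩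
      · exact ⟨s, by omega, x, h1, Or.inr h4, by simpa [h5] using h3⟩
      · obtain rfl : s = t := h2.resolve_right (by simp [h4])
        exact ⟨s + 1, le_rfl, x', by simp [stepN, h1, h4], Or.inl rfl, by simpa [h5] using h6⟩
  obtain ⟨s, hs, x, h1, h2, h3⟩ := key
  have hiff : Halts M.encode (w.map Fin.val) t ↔ M.step x = none := by
    unfold Halts
    rcases next_represents M h3 with ⟨h4, h5⟩ | ⟨x', z', h4, h5, h6⟩ <;> simp [h4, h5]
  rw [hiff]
  refine ⟨fun h => ⟨s, hs, x, h1, h⟩, ?_⟩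
  rintro ⟨s', hs', y, h4, h5⟩
  rcases h2 with rfl | h2
  · obtain rfl : s = s' := le_antisymm (le_of_halts M h4 h5 h1) hs'
    rw [h1, Option.some.injEq] at h4
    rwa [h4]
  · exact h2

theorem haltsOnShort_encode {n g : ℕ} (M : DTM (Fin n) (Fin g)) :
    HaltsOnShort M.encode ↔ ∀ w : List (Fin g), w.length ≤ behaviorCount n g →
      (∀ a ∈ w, a ∈ M.input) → M.HaltsWithin w (g * (w.length + 2 * behaviorCount n g)) := by
  have hN : behaviors M.encode = behaviorCount n g := rfl
  have hg : symbols M.encode = g := rfl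
  have hin : ∀ w : List (Fin g), (∀ a ∈ w.map Fin.val, (input M.encode).getD a false = true) ↔
      ∀ a ∈ w, a ∈ M.input := by
    intro w
    simp [input, encode]
  rw [HaltsOnShort, hN, hg]
  constructor
  · intro h w hl hw
    have := (h w.length (by omega) (w.map Fin.val) (mem_words.2 (by simp))).resolve_left
      (not_not.2 ((hin w).2 hw))
    rwa [halts_encode, List.length_map] at this
  · intro h k hk v hv
    obtain ⟨rfl, hlt⟩ := mem_words.1 hv
    obtain ⟨v, rfl⟩ : ∃ u : List (Fin g), u.map Fin.val = v :=
      ⟨v.pmap Fin.mk hlt, by simp [List.map_pmap]⟩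
    rw [hin, halts_encode, List.length_map]
    rw [List.length_map] at hk
    exact or_iff_not_imp_left.2 fun hw => h v (by omega) (not_not.1 hw)

end Code

end DTM

/-! ### Decidability -/

theorem mainTheorem11 :
    ComputablePred fun c : DTM.Code =>
      ∃ (n g : ℕ) (M : DTM (Fin n) (Fin g)),
        M.encode = c ∧ M.WeightReducing ∧ M.LinearTime := by
  refine ((DTM.Code.primrecPred_valid.and (DTM.Code.primrecPred_ranked.and
    DTM.Code.primrecPred_haltsOnShort)).computablePred).of_eq fun c => ?_
  rw [DTM.Code.valid_iff]
  have key : ∀ (n g : ℕ) (M : DTM (Fin n) (Fin g)), M.WeightReducing →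
      (DTM.Code.HaltsOnShort M.encode ↔ M.LinearTime) := by
    intro n g M h
    obtain ⟨r, hr, hg⟩ := h.exists_rank
    rw [DTM.Code.haltsOnShort_encode, DTM.linearTime_iff hr hg, DTM.card_behaviorType,
      Nat.card_fin]
  constructor
  · rintro ⟨⟨n, g, M, rfl⟩, h1, h2⟩
    rw [DTM.Code.ranked_encode] at h1
    exact ⟨n, g, M, rfl, h1, (key n g M h1).1 h2⟩
  · rintro ⟨n, g, M, rfl, h1, h2⟩
    exact ⟨⟨n, g, M, rfl⟩, (DTM.Code.ranked_encode M).2 h1, (key n g M h1).2 h2⟩
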